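/- **Setting.** Let $n,k$ be natural numbers. Four observed variables $X_1,X_2,X_3,X_4$ with $n$ states each and two hidden variables $H,G$ with $k$ states each form a quartet with the correct relation $\{\{1,2\},\{3,4\}\}$: for conditional probability tables $P_{1|H},P_{2|H},P_{3|G},P_{4|G}$ and a joint probability table $P_{HG}$, the joint probability table of $(X_1,X_2,X_3,X_4)$ is $$\mathcal P(x_1,x_2,x_3,x_4)=\sum_{h,g}P(x_1|h)\,P(x_2|h)\,P(h,g)\,P(x_3|g)\,P(x_4|g).$$ The unfoldings $A,B,C$ of a tensor of size $n\times n\times n\times n$ are the $n^2\times n^2$ matrices with the same entries, whose rows are indexed by $(x_1,x_2)$, $(x_1,x_3)$, $(x_1,x_4)$ and whose columns are indexed by $(x_3,x_4)$, $(x_2,x_4)$, $(x_2,x_3)$, respectively. Let $\|\cdot\|_*$ be the nuclear norm (the sum of the singular values) and $\|\cdot\|_F$ the Frobenius norm. With $A,B,C$ the unfoldings of $\mathcal P$, put $$\alpha=\min\{\|B\|_*-\|A\|_*,\ \|C\|_*-\|A\|_*\}.$$ Let $P_H,P_G$ be the marginals of $P_{HG}$, let $\Delta=P_{HG}-P_HP_G^\top$,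 let $A_\perp,B_\perp,C_\perp$ be the unfoldings of the tensor obtained from $\mathcal P$ by replacing $P_{HG}$ with $P_HP_G^\top$, and let $\theta=\min\{\|B_\perp\|_*-\|A_\perp\|_*,\ \|C_\perp\|_*-\|A_\perp\|_*\}$. Assume the recovery condition $\|\Delta\|_F\le\theta/(k^2+k)$. **Test.** Given $m$ samples, form the empirical probability table $\widehat{\mathcal P}$ and its unfoldings $\widehat A,\widehat B,\widehat C$. The nuclear norm quartet test returns the relation $\{\{1,2\},\{3,4\}\}$, $\{\{1,3\},\{2,4\}\}$ or $\{\{1,4\},\{2,3\}\}$ according to which of $\|\widehat A\|_*$, $\|\widehat B\|_*$, $\|\widehat C\|_*$ is the smallest; the test counts as returning the correct relation only if $\|\widehat A\|_*$ is strictly smaller than the other two. **Lemma.** There is a threshold $m_0(n,\alpha)$, depending only on $n$ and $\alpha$, such that for every such quartet and every $m\ge m_0(n,\alpha)$, the quartet test applied to $m$ i.i.d. samples of $(X_1,X_2,X_3,X_4)$ returns the correct relation $\{\{1,2\},\{3,4\}\}$ with probability at least $$1-8\,e^{-m\alpha^2/32}.$$ -/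

import Mathlib

open MeasureTheory ProbabilityTheory

noncomputable section

/-- The nuclear norm of a real square matrix: the sum of its singular values. -/
def nuclearNorm {ι : Type} [Fintype ι] [DecidableEq ι] (M : Matrix ι ι ℝ) : ℝ :=
  ∑ i ∈ Finset.range (Fintype.card ι), (Matrix.toEuclideanLin M).singularValues i

/-- The Frobenius norm of a real matrix. -/
def frobNorm {ι κ : Type} [Fintype ι] [Fintype κ] (M : Matrix ι κ ℝ) : ℝ :=
  Real.sqrt (∑ i, ∑ j, M i j ^ 2)

/-- The three ways to pair up the four observed variables of a quartet. -/
inductive QuartetRelation where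
  /-- the relation `{{1,2},{3,4}}` -/
  | r12_34
  /-- the relation `{{1,3},{2,4}}` -/
  | r13_24
  /-- the relation `{{1,4},{2,3}}` -/
  | r14_23

/-- A joint state `(x₁, x₂, x₃, x₄)` of four observed variables with `n` states each. -/
abbrev Obs (n : ℕ) : Type := Fin n × Fin n × Fin n × Fin n

/-- A fourth order tensor of size `n × n × n × n`. -/
abbrev Tensor4 (n : ℕ) : Type := Fin n → Fin n → Fin n → Fin n → ℝ

/-- The unfolding `A`: rows are the dimensions 1, 2 and columns are the dimensions 3, 4. -/
def unfoldA {n : ℕ} (T : Tensor4 n) : Matrix (Fin n × Fin n) (Fin n × Fin n) ℝ :=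
  Matrix.of fun r c => T r.1 r.2 c.1 c.2

/-- The unfolding `B`: rows are the dimensions 1, 3 and columns are the dimensions 2, 4. -/
def unfoldB {n : ℕ} (T : Tensor4 n) : Matrix (Fin n × Fin n) (Fin n × Fin n) ℝ :=
  Matrix.of fun r c => T r.1 c.1 r.2 c.2

/-- The unfolding `C`: rows are the dimensions 1, 4 and columns are the dimensions 2, 3. -/
def unfoldC {n : ℕ} (T : Tensor4 n) : Matrix (Fin n × Fin n) (Fin n × Fin n) ℝ :=
  Matrix.of fun r c => T r.1 c.1 c.2 r.2

/-- The unfolding that corresponds to a grouping of the four variables. -/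
def unfolding {n : ℕ} (T : Tensor4 n) :
    QuartetRelation → Matrix (Fin n × Fin n) (Fin n × Fin n) ℝ
  | .r12_34 => unfoldA T
  | .r13_24 => unfoldB T
  | .r14_23 => unfoldC T

/-- For a tensor `T`, the smaller of `‖B‖_* - ‖A‖_*` and `‖C‖_* - ‖A‖_*`. -/
def nuclearGap {n : ℕ} (T : Tensor4 n) : ℝ :=
  min (nuclearNorm (unfoldB T) - nuclearNorm (unfoldA T))
    (nuclearNorm (unfoldC T) - nuclearNorm (unfoldA T))

/-- The empirical joint probability table of `m` samples. -/
def empiricalTensor {n m : ℕ} (s : Fin m → Obs n) : Tensor4 n := fun x₁ x₂ x₃ x₄ =>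
  ((Finset.univ.filter fun l => s l = (x₁, x₂, x₃, x₄)).card : ℝ) / m

/-- The possible outputs of the nuclear norm quartet test on the samples `s`: the relations whose
empirical unfolding has the smallest nuclear norm (several if there is a tie). -/
def quartetTest {n m : ℕ} (s : Fin m → Obs n) : Set QuartetRelation :=
  {r | ∀ r', nuclearNorm (unfolding (empiricalTensor s) r) ≤
    nuclearNorm (unfolding (empiricalTensor s) r')}

/-- The parameters of a quartet with the relation `{{1,2},{3,4}}`: observed variables `X₁, …, X₄`
with `n` states each, hidden variables `H` (the neighbour of `X₁, X₂`) and `G` (the neighbour of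
`X₃, X₄`) with `k` states each. -/
structure QuartetModel (n k : ℕ) where
  /-- the conditional probability table `P(X₁ = x | H = h)` -/
  P1H : Matrix (Fin n) (Fin k) ℝ
  /-- the conditional probability table `P(X₂ = x | H = h)` -/
  P2H : Matrix (Fin n) (Fin k) ℝ
  /-- the conditional probability table `P(X₃ = x | G = g)` -/
  P3G : Matrix (Fin n) (Fin k) ℝ
  /-- the conditional probability table `P(X₄ = x | G = g)` -/
  P4G : Matrix (Fin n) (Fin k) ℝ
  /-- the joint probability table `P(H = h, G = g)` -/
  PHG : Matrix (Fin k) (Fin k) ℝ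
  P1H_nonneg : ∀ x h, 0 ≤ P1H x h
  P2H_nonneg : ∀ x h, 0 ≤ P2H x h
  P3G_nonneg : ∀ x g, 0 ≤ P3G x g
  P4G_nonneg : ∀ x g, 0 ≤ P4G x g
  PHG_nonneg : ∀ h g, 0 ≤ PHG h g
  P1H_sum : ∀ h, ∑ x, P1H x h = 1
  P2H_sum : ∀ h, ∑ x, P2H x h = 1
  P3G_sum : ∀ g, ∑ x, P3G x g = 1
  P4G_sum : ∀ g, ∑ x, P4G x g = 1
  PHG_sum : ∑ h, ∑ g, PHG h g = 1

namespace QuartetModel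

variable {n k : ℕ} (M : QuartetModel n k)

/-- The tensor `∑_{h,g} P(x₁|h) P(x₂|h) Q(h,g) P(x₃|g) P(x₄|g)` for a table `Q` in place of
`P(h,g)`. -/
def tensorWith (Q : Matrix (Fin k) (Fin k) ℝ) : Tensor4 n := fun x₁ x₂ x₃ x₄ =>
  ∑ h, ∑ g, M.P1H x₁ h * M.P2H x₂ h * Q h g * M.P3G x₃ g * M.P4G x₄ g

/-- The joint probability table of `X₁, X₂, X₃, X₄`. -/
def tensor : Tensor4 n := M.tensorWith M.PHG

/-- The marginal distribution of `H`. -/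
def PH (h : Fin k) : ℝ := ∑ g, M.PHG h g

/-- The marginal distribution of `G`. -/
def PG (g : Fin k) : ℝ := ∑ h, M.PHG h g

/-- The table `P_H P_Gᵀ` of the case in which `H` and `G` are independent. -/
def indepHG : Matrix (Fin k) (Fin k) ℝ := Matrix.vecMulVec M.PH M.PG

/-- The joint table of `X₁, …, X₄` when `P_HG` is replaced by `P_H P_Gᵀ`; its unfoldings are
`A_⊥, B_⊥, C_⊥`. -/
def tensorIndep : Tensor4 n := M.tensorWith M.indepHG

/-- The deviation `Δ = P_HG - P_H P_Gᵀ` from independence. Because `P_H` and `P_G` are the marginals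
of `P_HG`, all row sums and all column sums of `Δ` are zero. -/
def Delta : Matrix (Fin k) (Fin k) ℝ := M.PHG - M.indepHG

/-- The excessive dependence `θ = min {‖B_⊥‖_* - ‖A_⊥‖_*, ‖C_⊥‖_* - ‖A_⊥‖_*}`. -/
def theta : ℝ := nuclearGap M.tensorIndep

/-- The gap `α = min {‖B‖_* - ‖A‖_*, ‖C‖_* - ‖A‖_*}`. -/
def alpha : ℝ := nuclearGap M.tensor

/-- The recovery condition `‖Δ‖_F ≤ θ / (k² + k)`. -/
def RecoveryCondition : Prop := frobNorm M.Delta ≤ M.theta / ((k : ℝ) ^ 2 + k)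

end QuartetModel

end

/-!
The nuclear norm is 1-Lipschitz for the entrywise `ℓ¹` norm (`nuclearNorm_sub_le`): by the singular
value decomposition it is the maximum of `∑ i, ⟪b i, M (c i)⟫` over pairs of orthonormal bases, and
each entry of `M` enters such a sum with a coefficient of absolute value at most one. Two
consequences carry the proof.

*The gap is not negative.* Replacing `P_H P_Gᵀ` by `P_HG` moves the joint table, and hence each of
the three nuclear norms, by at most `∑ |Δ| ≤ k ‖Δ‖_F`. So `α ≥ θ - 2 k ‖Δ‖_F`, which the recovery
condition makes nonnegative (`QuartetModel.alpha_nonneg`). If `α = 0`, the asserted bound is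
negative.

*Concentration.* Changing one of the `m` samples moves the empirical table by at most `2 / m` in
`ℓ¹`, so the difference of two empirical nuclear norms by at most `4 / m`. As in McDiarmid's
inequality, Hoeffding's lemma applied to one sample at a time makes this difference sub-Gaussian
(`iidExp_exp_sub_mean_le`). The variance of the empirical frequencies shows that its mean differs
from the population value by at most `2 n⁴ / √m`, which is below `α / 2` once `m ≥ (4 n⁴ / α)²`.
Then a wrong relation has an empirical norm as small as the correct one with probability at most
`exp (-m α² / 32)` (`iidExp_indicator_nonneg_le`), and there are two wrong relations.

Since the samples take finitely many values, expectations over them are written as finite sums with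
product weights (`iidExp`).
-/

/-! ### Singular value decomposition and the nuclear norm -/

section NuclearNorm

variable {E : Type*} [NormedAddCommGroup E] [InnerProductSpace ℝ E] [FiniteDimensional ℝ E]

/-- Singular value decomposition of an endomorphism. -/
theorem LinearMap.exists_orthonormalBasis_apply_eq_singularValues_smul (T : E →ₗ[ℝ] E) {n : ℕ}
    (hn : Module.finrank ℝ E = n) :
    ∃ u v : OrthonormalBasis (Fin n) ℝ E, ∀ i, T (v i) = T.singularValues i • u i := by
  set v := T.isSymmetric_adjoint_comp_self.eigenvectorBasis hn with hv
  have key : ∀ i j, inner ℝ (T (v i)) (T (v j)) =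
      T.singularValues j ^ 2 * (if i = j then 1 else 0) := by
    intro i j
    rw [← LinearMap.adjoint_inner_right, ← LinearMap.comp_apply, hv,
      T.isSymmetric_adjoint_comp_self.apply_eigenvectorBasis hn j, inner_smul_right,
      T.sq_singularValues_fin hn, ← hv, orthonormal_iff_ite.mp v.orthonormal i j]
    rfl
  -- The left singular vectors of the zero singular values are supplied by a basis extension.
  have horth : Orthonormal ℝ (Set.domRestrict {i : Fin n | T.singularValues i ≠ 0}
      fun i => (T.singularValues i)⁻¹ • T (v i)) := by
    rw [orthonormal_iff_ite]
    rintro ⟨i, hi⟩ ⟨j, hj⟩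
    simp only [Set.mem_ofPred_eq] at hi hj
    change inner ℝ ((T.singularValues i)⁻¹ • T (v i)) ((T.singularValues j)⁻¹ • T (v j)) = _
    simp only [inner_smul_left, inner_smul_right, key, Subtype.mk.injEq, RCLike.conj_to_real]
    split_ifs with h
    · subst h
      field_simp
    · simp
  obtain ⟨u, hu⟩ := horth.exists_orthonormalBasis_extension_of_card_eq (by simpa using hn)
  refine ⟨u, v, fun i => ?_⟩
  by_cases hi : T.singularValues i = 0
  · have := key i i
    rw [hi] at this
    rw [hi, zero_smul, ← inner_self_eq_zero (𝕜 := ℝ), this]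
    simp
  · rw [hu i hi, smul_smul, mul_inv_cancel₀ hi, one_smul]

omit [FiniteDimensional ℝ E] in
theorem OrthonormalBasis.abs_sum_inner_mul_inner_le_one {ι : Type*} [Fintype ι]
    (b c : OrthonormalBasis ι ℝ E) {x y : E} (hx : ‖x‖ = 1) (hy : ‖y‖ = 1) :
    |∑ i, inner ℝ (b i) x * inner ℝ (c i) y| ≤ 1 := by
  calc |∑ i, inner ℝ (b i) x * inner ℝ (c i) y|
      ≤ ∑ i, |inner ℝ (b i) x * inner ℝ (c i) y| := Finset.abs_sum_le_sum_abs _ _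
    _ ≤ ∑ i, (inner ℝ (b i) x ^ 2 + inner ℝ (c i) y ^ 2) / 2 := by
        refine Finset.sum_le_sum fun i _ => ?_
        rw [abs_mul, ← sq_abs (inner ℝ (b i) x), ← sq_abs (inner ℝ (c i) y)]
        linarith [two_mul_le_add_sq |inner ℝ (b i) x| |inner ℝ (c i) y|]
    _ = 1 := by
        rw [← Finset.sum_div, Finset.sum_add_distrib, b.sum_sq_inner_right, c.sum_sq_inner_right,
          hx, hy]
        norm_num

/-- One half of the duality between the nuclear and the operator norm. -/
theorem LinearMap.sum_inner_apply_le_sum_singularValues (T : E →ₗ[ℝ] E) {n : ℕ}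
    (hn : Module.finrank ℝ E = n) (b c : OrthonormalBasis (Fin n) ℝ E) :
    ∑ i, inner ℝ (b i) (T (c i)) ≤ ∑ j : Fin n, T.singularValues j := by
  obtain ⟨u, v, huv⟩ := T.exists_orthonormalBasis_apply_eq_singularValues_smul hn
  have h1 : ∀ i, inner ℝ (b i) (T (c i)) =
      ∑ j : Fin n, T.singularValues j * (inner ℝ (b i) (u j) * inner ℝ (c i) (v j)) := by
    intro i
    conv_lhs => rw [← v.sum_repr' (c i)]
    simp only [map_sum, map_smul, huv, inner_sum, inner_smul_right]
    refine Finset.sum_congr rfl fun j _ => ?_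
    rw [real_inner_comm (c i) (v j)]
    ring
  simp_rw [h1]
  rw [Finset.sum_comm]
  refine Finset.sum_le_sum fun j _ => ?_
  rw [← Finset.mul_sum]
  exact mul_le_of_le_one_right (T.singularValues_nonneg _)
    ((le_abs_self _).trans (b.abs_sum_inner_mul_inner_le_one c (u.norm_eq_one j) (v.norm_eq_one j)))

/-- The nuclear norm is 1-Lipschitz for the entrywise `ℓ¹` norm, since a matrix with a single
entry `a` has nuclear norm `|a|`. -/
theorem nuclearNorm_sub_le {ι : Type} [Fintype ι] [DecidableEq ι] (M N : Matrix ι ι ℝ) :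
    nuclearNorm M - nuclearNorm N ≤ ∑ i, ∑ j, |M i j - N i j| := by
  have hn : Module.finrank ℝ (EuclideanSpace ℝ ι) = Fintype.card ι := by simp
  obtain ⟨u, v, huv⟩ :=
    (Matrix.toEuclideanLin M).exists_orthonormalBasis_apply_eq_singularValues_smul hn
  have hM : nuclearNorm M = ∑ i, inner ℝ (u i) (Matrix.toEuclideanLin M (v i)) := by
    simp [nuclearNorm, Finset.sum_range, huv, inner_smul_right]
  have hN : ∑ i, inner ℝ (u i) (Matrix.toEuclideanLin N (v i)) ≤ nuclearNorm N := by
    simpa [nuclearNorm, Finset.sum_range] using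
      (Matrix.toEuclideanLin N).sum_inner_apply_le_sum_singularValues hn u v
  have hD : ∑ i, inner ℝ (u i) (Matrix.toEuclideanLin (M - N) (v i)) =
      ∑ a, ∑ b, (M a b - N a b) * ∑ i, inner ℝ (u i) (EuclideanSpace.single a (1 : ℝ)) *
        inner ℝ (v i) (EuclideanSpace.single b (1 : ℝ)) := by
    have h : ∀ i, inner ℝ (u i) (Matrix.toEuclideanLin (M - N) (v i)) =
        ∑ a, ∑ b, (M a b - N a b) * (inner ℝ (u i) (EuclideanSpace.single a (1 : ℝ)) *
          inner ℝ (v i) (EuclideanSpace.single b (1 : ℝ))) := by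
      intro i
      simp only [EuclideanSpace.inner_single_right, RCLike.conj_to_real, one_mul]
      simp only [PiLp.inner_apply, Matrix.toLpLin_apply, Matrix.mulVec, dotProduct,
        Finset.sum_mul, Matrix.sub_apply, RCLike.inner_apply, RCLike.conj_to_real]
      exact Finset.sum_congr rfl fun a _ => Finset.sum_congr rfl fun b _ => by ring
    simp_rw [h, Finset.mul_sum]
    rw [Finset.sum_comm]
    exact Finset.sum_congr rfl fun a _ => Finset.sum_comm
  have hsub : nuclearNorm M - nuclearNorm N ≤
      ∑ i, inner ℝ (u i) (Matrix.toEuclideanLin (M - N) (v i)) := by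
    simp only [map_sub, LinearMap.sub_apply, inner_sub_right, Finset.sum_sub_distrib]
    linarith
  refine hsub.trans ?_
  rw [hD]
  refine Finset.sum_le_sum fun a _ => Finset.sum_le_sum fun b _ => (le_abs_self _).trans ?_
  rw [abs_mul]
  exact mul_le_of_le_one_right (abs_nonneg _)
    (u.abs_sum_inner_mul_inner_le_one v (by simp) (by simp))

end NuclearNorm

/-! ### Concentration for functions of independent samples -/

section Concentration

variable {S : Type*} [Fintype S] {p : S → ℝ}

/-- Expectation of `f` over `m` independent samples drawn from the finite distribution `p`. -/
noncomputable def iidExp (p : S → ℝ) {m : ℕ} (f : (Fin m → S) → ℝ) : ℝ :=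
  ∑ s, (∏ l, p (s l)) * f s

theorem iidExp_zero (f : (Fin 0 → S) → ℝ) : iidExp p f = f Fin.elim0 := by
  simp only [iidExp, Finset.univ_unique, Finset.univ_eq_empty, Finset.prod_empty, one_mul,
    Finset.sum_singleton]
  exact congrArg f (Subsingleton.elim _ _)

theorem iidExp_succ {m : ℕ} (f : (Fin (m + 1) → S) → ℝ) :
    iidExp p f = ∑ a, p a * iidExp p fun s => f (Fin.cons a s) := by
  simp only [iidExp, Finset.mul_sum]
  rw [← (Fin.consEquiv fun _ => S).sum_comp, Fintype.sum_prod_type]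
  refine Finset.sum_congr rfl fun a _ => Finset.sum_congr rfl fun s _ => ?_
  simp [Fin.consEquiv, Fin.prod_univ_succ, mul_assoc]

theorem iidExp_add {m : ℕ} (f g : (Fin m → S) → ℝ) :
    iidExp p (fun s => f s + g s) = iidExp p f + iidExp p g := by
  simp [iidExp, mul_add, Finset.sum_add_distrib]

theorem iidExp_mul_left {m : ℕ} (c : ℝ) (f : (Fin m → S) → ℝ) :
    iidExp p (fun s => c * f s) = c * iidExp p f := by
  simp only [iidExp, Finset.mul_sum]
  exact Finset.sum_congr rfl fun s _ => by ring

theorem iidExp_sum {ι : Type*} (t : Finset ι) {m : ℕ} (f : ι → (Fin m → S) → ℝ) :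
    iidExp p (fun s => ∑ i ∈ t, f i s) = ∑ i ∈ t, iidExp p (f i) := by
  simp only [iidExp, Finset.mul_sum]
  exact Finset.sum_comm

theorem iidExp_mono (hp : ∀ a, 0 ≤ p a) {m : ℕ} {f g : (Fin m → S) → ℝ} (h : ∀ s, f s ≤ g s) :
    iidExp p f ≤ iidExp p g :=
  Finset.sum_le_sum fun s _ =>
    mul_le_mul_of_nonneg_left (h s) (Finset.prod_nonneg fun _ _ => hp _)

theorem iidExp_const (hp1 : ∑ a, p a = 1) {m : ℕ} (c : ℝ) :
    iidExp p (fun _ : Fin m → S => c) = c := by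
  induction m with
  | zero => rw [iidExp_zero]
  | succ m ih => rw [iidExp_succ]; simp [ih, ← Finset.sum_mul, hp1]

/-- Hoeffding's lemma for a function of bounded oscillation on a finite probability space. -/
theorem sum_mul_exp_sub_mean_le (hp : ∀ a, 0 ≤ p a) (hp1 : ∑ a, p a = 1) {g : S → ℝ} {c : ℝ}
    (hg : ∀ a b, |g a - g b| ≤ c) (t : ℝ) :
    ∑ a, p a * Real.exp (t * (g a - ∑ b, p b * g b)) ≤ Real.exp (t ^ 2 * c ^ 2 / 8) := by
  let _ : MeasurableSpace S := ⊤
  have hne : Nonempty S := by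
    by_contra h
    rw [not_nonempty_iff] at h
    simp at hp1
  let q : PMF S := PMF.ofFintype (fun a => ENNReal.ofReal (p a)) (by
    rw [← ENNReal.ofReal_sum_of_nonneg fun a _ => hp a, hp1, ENNReal.ofReal_one])
  have hint : ∀ f : S → ℝ, ∫ a, f a ∂q.toMeasure = ∑ a, p a * f a := by
    intro f
    rw [PMF.integral_eq_sum]
    refine Finset.sum_congr rfl fun a _ => ?_
    rw [PMF.ofFintype_apply, ENNReal.toReal_ofReal (hp a), smul_eq_mul]
  obtain ⟨a₀, ha₀⟩ := Finite.exists_min g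
  have h := (hasSubgaussianMGF_of_mem_Icc (μ := q.toMeasure) (X := g) (a := g a₀) (b := g a₀ + c)
    (measurable_of_finite g).aemeasurable (Filter.Eventually.of_forall fun a =>
      ⟨ha₀ a, by linarith [(le_abs_self _).trans (hg a a₀)]⟩)).mgf_le t
  rw [mgf, hint, hint] at h
  refine h.trans (le_of_eq ?_)
  congr 1
  simp only [NNReal.coe_pow, NNReal.coe_div, coe_nnnorm, add_sub_cancel_left, Real.norm_eq_abs,
    div_pow, sq_abs, NNReal.coe_ofNat]
  ring

/-- The moment generating function bound behind McDiarmid's inequality: a function of `m`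
independent samples that moves by at most `c` when one sample changes is sub-Gaussian. -/
theorem iidExp_exp_sub_mean_le (hp : ∀ a, 0 ≤ p a) (hp1 : ∑ a, p a = 1) {c : ℝ} (t : ℝ) {m : ℕ}
    (f : (Fin m → S) → ℝ)
    (hf : ∀ s s' i, (∀ j, j ≠ i → s j = s' j) → |f s - f s'| ≤ c) :
    iidExp p (fun s => Real.exp (t * (f s - iidExp p f))) ≤
      Real.exp (m * (t ^ 2 * c ^ 2 / 8)) := by
  induction m with
  | zero => simp [iidExp_zero]
  | succ m ih =>
    set g : S → ℝ := fun a => iidExp p fun s => f (Fin.cons a s) with hg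
    have hmean : iidExp p f = ∑ b, p b * g b := iidExp_succ f
    have hosc : ∀ a b, |g a - g b| ≤ c := by
      have h : ∀ a b, g a ≤ g b + c := by
        intro a b
        rw [hg, ← iidExp_const (p := p) hp1 (m := m) c, ← iidExp_add]
        refine iidExp_mono hp fun s => ?_
        have := hf (Fin.cons a s) (Fin.cons b s) 0 fun j hj => by
          obtain ⟨j, rfl⟩ := Fin.exists_succ_eq.mpr hj
          simp
        linarith [(le_abs_self _).trans this]
      exact fun a b => abs_le.mpr ⟨by linarith [h b a], by linarith [h a b]⟩
    rw [iidExp_succ, hmean]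
    calc ∑ a, p a * iidExp p (fun s => Real.exp (t * (f (Fin.cons a s) - ∑ b, p b * g b)))
        = ∑ a, p a * Real.exp (t * (g a - ∑ b, p b * g b)) *
            iidExp p (fun s => Real.exp (t * (f (Fin.cons a s) - g a))) := by
          refine Finset.sum_congr rfl fun a _ => ?_
          rw [mul_assoc, ← iidExp_mul_left (Real.exp _)]
          simp_rw [← Real.exp_add]
          congr 3
          funext s
          ring_nf
      _ ≤ ∑ a, p a * Real.exp (t * (g a - ∑ b, p b * g b)) *
            Real.exp (m * (t ^ 2 * c ^ 2 / 8)) := by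
          refine Finset.sum_le_sum fun a _ =>
            mul_le_mul_of_nonneg_left ?_ (mul_nonneg (hp a) (Real.exp_pos _).le)
          refine ih _ fun s s' i h => hf _ _ i.succ fun j hj => ?_
          cases j using Fin.cases with
          | zero => simp
          | succ j => simpa using h j fun hji => hj (hji ▸ rfl)
      _ ≤ Real.exp (t ^ 2 * c ^ 2 / 8) * Real.exp (m * (t ^ 2 * c ^ 2 / 8)) := by
          rw [← Finset.sum_mul]
          exact mul_le_mul_of_nonneg_right (sum_mul_exp_sub_mean_le hp hp1 hosc t)
            (Real.exp_pos _).le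
      _ = Real.exp ((m + 1 : ℕ) * (t ^ 2 * c ^ 2 / 8)) := by
          rw [← Real.exp_add]
          push_cast
          ring_nf

theorem iidExp_sum_centered {h : S → ℝ} (hp1 : ∑ a, p a = 1) (h0 : ∑ a, p a * h a = 0) (m : ℕ) :
    iidExp p (fun s : Fin m → S => ∑ l, h (s l)) = 0 := by
  induction m with
  | zero => simp [iidExp_zero]
  | succ m ih =>
    simp [iidExp_succ, Fin.sum_univ_succ, iidExp_add, iidExp_const hp1, ih, h0]

theorem iidExp_sum_centered_sq {h : S → ℝ} (hp1 : ∑ a, p a = 1) (h0 : ∑ a, p a * h a = 0) (m : ℕ) :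
    iidExp p (fun s : Fin m → S => (∑ l, h (s l)) ^ 2) = m * ∑ a, p a * h a ^ 2 := by
  induction m with
  | zero => simp [iidExp_zero]
  | succ m ih =>
    simp only [iidExp_succ, Fin.sum_univ_succ, Fin.cons_zero, Fin.cons_succ, add_sq, iidExp_add,
      iidExp_const hp1, ih, iidExp_mul_left, iidExp_sum_centered hp1 h0]
    simp only [mul_zero, add_zero, mul_add, Finset.sum_add_distrib, ← Finset.sum_mul, hp1]
    push_cast
    ring

theorem iidExp_abs_le_sqrt (hp : ∀ a, 0 ≤ p a) (hp1 : ∑ a, p a = 1) {m : ℕ}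
    (f : (Fin m → S) → ℝ) : iidExp p (fun s => |f s|) ≤ √(iidExp p fun s => f s ^ 2) := by
  apply Real.le_sqrt_of_sq_le
  set e := iidExp p (fun s => |f s|) with he
  have h : iidExp p (fun s => (2 * e) * |f s| + -e ^ 2) ≤ iidExp p fun s => f s ^ 2 :=
    iidExp_mono hp fun s => by nlinarith [sq_nonneg (|f s| - e), sq_abs (f s)]
  rw [iidExp_add, iidExp_const hp1, iidExp_mul_left] at h
  nlinarith

/-- The mean deviation of an empirical frequency from its probability. -/
theorem iidExp_abs_frequency_sub_le [DecidableEq S] (hp : ∀ a, 0 ≤ p a) (hp1 : ∑ a, p a = 1)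
    {m : ℕ} (hm : 0 < m) (x : S) :
    iidExp p (fun s : Fin m → S =>
      |((Finset.univ.filter fun l => s l = x).card : ℝ) / m - p x|) ≤ 1 / √m := by
  have hm' : (0 : ℝ) < m := by exact_mod_cast hm
  set h : S → ℝ := fun a => (if a = x then 1 else 0) - p x with hh
  have h0 : ∑ a, p a * h a = 0 := by
    simp [hh, mul_sub, Finset.sum_sub_distrib, ← Finset.sum_mul, hp1]
  have hpx : p x ≤ 1 := hp1 ▸ Finset.single_le_sum (fun a _ => hp a) (Finset.mem_univ x)
  have hvar : ∑ a, p a * h a ^ 2 ≤ 1 := by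
    rw [← hp1]
    refine Finset.sum_le_sum fun a _ => mul_le_of_le_one_right (hp a) ?_
    have := hp x
    simp only [hh]
    split_ifs <;> nlinarith
  have heq : ∀ s : Fin m → S, ((Finset.univ.filter fun l => s l = x).card : ℝ) / m - p x =
      (m : ℝ)⁻¹ * ∑ l, h (s l) := by
    intro s
    simp only [hh, Finset.sum_sub_distrib, Finset.sum_boole, Finset.sum_const, Finset.card_univ,
      Fintype.card_fin, nsmul_eq_mul]
    field_simp
  simp_rw [heq]
  refine (iidExp_abs_le_sqrt hp hp1 _).trans ?_
  simp_rw [mul_pow]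
  rw [iidExp_mul_left, iidExp_sum_centered_sq hp1 h0, ← Real.sqrt_one, ← Real.sqrt_div zero_le_one]
  apply Real.sqrt_le_sqrt
  calc ((m : ℝ)⁻¹) ^ 2 * (m * ∑ a, p a * h a ^ 2) = (∑ a, p a * h a ^ 2) / m := by field_simp
    _ ≤ 1 / m := by gcongr

/-- An event about i.i.d. samples has the probability that the product weights give to it. -/
theorem measureReal_eq_iidExp_indicator [MeasurableSpace S] [MeasurableSingletonClass S]
    {Ω : Type*} [MeasurableSpace Ω] {μ : Measure Ω} [IsProbabilityMeasure μ] {m : ℕ}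
    {X : Fin m → Ω → S} (hX : ∀ l, Measurable (X l)) (hind : iIndepFun X μ)
    (hlaw : ∀ l a, μ.real {ω | X l ω = a} = p a) (B : Set (Fin m → S)) :
    μ.real {ω | (fun l => X l ω) ∈ B} = iidExp p (B.indicator 1) := by
  classical
  have hpt : ∀ s : Fin m → S, μ.real ((fun ω l => X l ω) ⁻¹' {s}) = ∏ l, p (s l) := by
    intro s
    have h := hind.measure_inter_preimage_eq_mul (S := Finset.univ) (sets := fun l => {s l})
      fun l _ => measurableSet_singleton _
    have hset : (fun ω l => X l ω) ⁻¹' {s} = ⋂ l ∈ Finset.univ, X l ⁻¹' {s l} := by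
      ext ω
      simp [funext_iff]
    rw [hset, Measure.real, h, ENNReal.toReal_prod]
    exact Finset.prod_congr rfl fun l _ => hlaw l (s l)
  have hset : {ω | (fun l => X l ω) ∈ B} = (fun ω l => X l ω) ⁻¹'
      ((Finset.univ.filter (· ∈ B) : Finset (Fin m → S)) : Set (Fin m → S)) := by
    ext ω
    simp
  rw [hset, ← sum_measureReal_preimage_singleton _ fun s _ =>
    measurable_pi_lambda _ hX (measurableSet_singleton s)]
  simp_rw [hpt, iidExp, Finset.sum_filter]
  refine Finset.sum_congr rfl fun s _ => ?_
  by_cases hs : s ∈ B <;> simp [hs]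

/-- Chernoff's method: a statistic of negative mean and bounded differences is rarely
nonnegative. -/
theorem iidExp_indicator_nonneg_le (hp : ∀ a, 0 ≤ p a) (hp1 : ∑ a, p a = 1) {m : ℕ} (hm : 0 < m)
    {a : ℝ} (ha : 0 < a) (f : (Fin m → S) → ℝ)
    (hf : ∀ s s' i, (∀ j, j ≠ i → s j = s' j) → |f s - f s'| ≤ 4 / m)
    (hmean : iidExp p f ≤ -(a / 2)) :
    iidExp p ({s | 0 ≤ f s}.indicator 1) ≤ Real.exp (-(m * a ^ 2 / 32)) := by
  have hm' : (0 : ℝ) < m := by exact_mod_cast hm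
  -- This `t` minimises the exponent `-t * (a / 2) + 2 * t ^ 2 / m`.
  set t : ℝ := m * a / 8 with ht
  have htpos : 0 ≤ t := by positivity
  calc iidExp p ({s | 0 ≤ f s}.indicator 1)
      ≤ iidExp p (fun s => Real.exp (-(t * (a / 2))) *
          Real.exp (t * (f s - iidExp p f))) := by
        refine iidExp_mono hp fun s => ?_
        by_cases hs : 0 ≤ f s
        · rw [Set.indicator_of_mem (by exact hs), ← Real.exp_add, Pi.one_apply, Real.one_le_exp_iff]
          nlinarith [mul_nonneg htpos hs]
        · rw [Set.indicator_of_notMem (by exact hs)]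
          positivity
    _ ≤ Real.exp (-(t * (a / 2))) * Real.exp (m * (t ^ 2 * (4 / m) ^ 2 / 8)) := by
        rw [iidExp_mul_left]
        exact mul_le_mul_of_nonneg_left (iidExp_exp_sub_mean_le hp hp1 t f hf) (Real.exp_pos _).le
    _ = Real.exp (-(m * a ^ 2 / 32)) := by
        rw [← Real.exp_add, ht]
        congr 1
        field_simp
        ring

end Concentration

/-! ### Unfoldings of fourth order tensors -/

section Tensor

variable {n : ℕ}

/-- The entrywise `ℓ¹` distance of two tensors, viewed as functions on joint states. -/
noncomputable def l1Dist (T U : Tensor4 n) : ℝ :=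
  ∑ x : Obs n, |T x.1 x.2.1 x.2.2.1 x.2.2.2 - U x.1 x.2.1 x.2.2.1 x.2.2.2|

theorem l1Dist_eq (T U : Tensor4 n) :
    l1Dist T U = ∑ a, ∑ b, ∑ c, ∑ d, |T a b c d - U a b c d| := by
  simp only [l1Dist, Fintype.sum_prod_type]

theorem l1Dist_comm (T U : Tensor4 n) : l1Dist T U = l1Dist U T := by
  simp only [l1Dist, abs_sub_comm]

theorem sum_abs_unfolding_sub (T U : Tensor4 n) (r : QuartetRelation) :
    ∑ i, ∑ j, |unfolding T r i j - unfolding U r i j| = l1Dist T U := by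
  rw [l1Dist_eq]
  cases r <;> simp only [unfolding, unfoldA, unfoldB, unfoldC, Matrix.of_apply,
    Fintype.sum_prod_type]
  · refine Finset.sum_congr rfl fun a _ => ?_
    rw [Finset.sum_comm]
  · refine Finset.sum_congr rfl fun a _ => ?_
    rw [Finset.sum_comm]
    refine Finset.sum_congr rfl fun b _ => ?_
    rw [Finset.sum_comm]

theorem abs_nuclearNorm_unfolding_sub_le (T U : Tensor4 n) (r : QuartetRelation) :
    |nuclearNorm (unfolding T r) - nuclearNorm (unfolding U r)| ≤ l1Dist T U := by
  refine abs_le.mpr ⟨?_, (nuclearNorm_sub_le _ _).trans_eq (sum_abs_unfolding_sub T U r)⟩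
  have := (nuclearNorm_sub_le (unfolding U r) (unfolding T r)).trans_eq
    (sum_abs_unfolding_sub U T r)
  rw [l1Dist_comm] at this
  linarith

theorem nuclearGap_le_of_ne (T : Tensor4 n) {r : QuartetRelation} (hr : r ≠ .r12_34) :
    nuclearGap T ≤ nuclearNorm (unfolding T r) - nuclearNorm (unfolding T .r12_34) := by
  cases r with
  | r12_34 => exact absurd rfl hr
  | r13_24 => exact min_le_left _ _
  | r14_23 => exact min_le_right _ _

theorem nuclearGap_le_add (T U : Tensor4 n) :
    nuclearGap T ≤ nuclearGap U + 2 * l1Dist T U := by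
  have h := fun r => abs_le.mp (abs_nuclearNorm_unfolding_sub_le T U r)
  have hA := h .r12_34
  have hB := h .r13_24
  have hC := h .r14_23
  simp only [unfolding] at hA hB hC
  rw [nuclearGap, nuclearGap, ← sub_le_iff_le_add]
  refine le_min ?_ ?_
  · linarith [min_le_left (nuclearNorm (unfoldB T) - nuclearNorm (unfoldA T))
      (nuclearNorm (unfoldC T) - nuclearNorm (unfoldA T))]
  · linarith [min_le_right (nuclearNorm (unfoldB T) - nuclearNorm (unfoldA T))
      (nuclearNorm (unfoldC T) - nuclearNorm (unfoldA T))]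

end Tensor

/-! ### The population gap of a quartet -/

theorem sum_abs_le_card_mul_frobNorm {k : ℕ} (D : Matrix (Fin k) (Fin k) ℝ) :
    ∑ h, ∑ g, |D h g| ≤ k * frobNorm D := by
  have hcs := sq_sum_le_card_mul_sum_sq (s := (Finset.univ : Finset (Fin k × Fin k)))
    (f := fun x => |D x.1 x.2|)
  simp only [sq_abs, Finset.card_univ, Fintype.card_prod, Fintype.card_fin,
    Fintype.sum_prod_type] at hcs
  rw [frobNorm, ← Real.sqrt_sq (Nat.cast_nonneg (α := ℝ) k), ← Real.sqrt_mul (sq_nonneg _)]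
  apply Real.le_sqrt_of_sq_le
  push_cast at hcs
  linarith

namespace QuartetModel

variable {n k : ℕ} (M : QuartetModel n k)

theorem tensor_nonneg (a b c d : Fin n) : 0 ≤ M.tensor a b c d := by
  rw [tensor, tensorWith]
  exact Finset.sum_nonneg fun h _ => Finset.sum_nonneg fun g _ =>
    mul_nonneg (mul_nonneg (mul_nonneg (mul_nonneg (M.P1H_nonneg _ _) (M.P2H_nonneg _ _))
      (M.PHG_nonneg _ _)) (M.P3G_nonneg _ _)) (M.P4G_nonneg _ _)

theorem sum_tensorWith (Q : Matrix (Fin k) (Fin k) ℝ) :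
    ∑ a, ∑ b, ∑ c, ∑ d, M.tensorWith Q a b c d = ∑ h, ∑ g, Q h g := by
  have e : ∀ h g, ∑ a, ∑ b, ∑ c, ∑ d,
      M.P1H a h * M.P2H b h * Q h g * M.P3G c g * M.P4G d g = Q h g := by
    intro h g
    simp only [← Finset.mul_sum, M.P4G_sum, M.P3G_sum, mul_one, ← Finset.sum_mul, M.P2H_sum,
      M.P1H_sum, one_mul]
  simp only [tensorWith]
  simp_rw [Finset.sum_comm (s := (Finset.univ : Finset (Fin n)))
    (t := (Finset.univ : Finset (Fin k))), e]

theorem sum_tensor : ∑ x : Obs n, M.tensor x.1 x.2.1 x.2.2.1 x.2.2.2 = 1 := by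
  simp only [Fintype.sum_prod_type]
  exact (M.sum_tensorWith M.PHG).trans M.PHG_sum

/-- Passing a table through the conditional probability tables contracts the `ℓ¹` norm. -/
theorem l1Dist_tensorWith_le (Q R : Matrix (Fin k) (Fin k) ℝ) :
    l1Dist (M.tensorWith Q) (M.tensorWith R) ≤ ∑ h, ∑ g, |(Q - R) h g| := by
  rw [l1Dist_eq, ← M.sum_tensorWith fun h g => |(Q - R) h g|]
  refine Finset.sum_le_sum fun a _ => Finset.sum_le_sum fun b _ => Finset.sum_le_sum fun c _ =>
    Finset.sum_le_sum fun d _ => ?_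
  simp only [tensorWith, ← Finset.sum_sub_distrib]
  refine (Finset.abs_sum_le_sum_abs _ _).trans (Finset.sum_le_sum fun h _ =>
    (Finset.abs_sum_le_sum_abs _ _).trans (Finset.sum_le_sum fun g _ => le_of_eq ?_))
  rw [← sub_mul, ← sub_mul, ← mul_sub, abs_mul, abs_mul, abs_mul, abs_mul,
    abs_of_nonneg (M.P1H_nonneg a h), abs_of_nonneg (M.P2H_nonneg b h),
    abs_of_nonneg (M.P3G_nonneg c g), abs_of_nonneg (M.P4G_nonneg d g), Matrix.sub_apply]

/-- Under the recovery condition the population version of the test does not fail: replacing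
`P_H P_Gᵀ` by `P_HG` lowers the gap `θ` by at most `2 k ‖Δ‖_F ≤ (k² + k) ‖Δ‖_F`. -/
theorem alpha_nonneg (hM : M.RecoveryCondition) : 0 ≤ M.alpha := by
  have hk : (1 : ℝ) ≤ k := by
    rcases Nat.eq_zero_or_pos k with rfl | hk
    · simpa using M.PHG_sum
    · exact_mod_cast hk
  have h1 : M.theta ≤ M.alpha + 2 * l1Dist M.tensorIndep M.tensor := nuclearGap_le_add _ _
  have h2 : l1Dist M.tensorIndep M.tensor ≤ k * frobNorm M.Delta := by
    rw [l1Dist_comm]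
    exact (M.l1Dist_tensorWith_le M.PHG M.indepHG).trans (sum_abs_le_card_mul_frobNorm M.Delta)
  have h3 : frobNorm M.Delta * ((k : ℝ) ^ 2 + k) ≤ M.theta :=
    (le_div_iff₀ (by positivity)).mp hM
  have h4 : 0 ≤ frobNorm M.Delta := Real.sqrt_nonneg _
  nlinarith [mul_nonneg (mul_nonneg h4 (sub_nonneg.mpr hk)) (Nat.cast_nonneg (α := ℝ) k)]

end QuartetModel

/-! ### The empirical unfoldings -/

section Empirical

variable {n m : ℕ}

/-- Changing one of `m` samples moves the empirical table by at most `2 / m` in `ℓ¹`. -/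
theorem l1Dist_empiricalTensor_le {s s' : Fin m → Obs n} {i : Fin m}
    (h : ∀ j, j ≠ i → s j = s' j) :
    l1Dist (empiricalTensor s) (empiricalTensor s') ≤ 2 / m := by
  have hcard : ∀ (s : Fin m → Obs n) (x : Obs n),
      ((Finset.univ.filter fun l => s l = x).card : ℝ) = (if s i = x then 1 else 0) +
        ∑ l ∈ Finset.univ.erase i, if s l = x then 1 else 0 := by
    intro s x
    rw [Finset.add_sum_erase _ (fun l => if s l = x then (1 : ℝ) else 0) (Finset.mem_univ i),
      Finset.sum_boole]
  have hdiff : ∀ x : Obs n, |((Finset.univ.filter fun l => s l = x).card : ℝ) / m -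
      ((Finset.univ.filter fun l => s' l = x).card : ℝ) / m| ≤
        ((if s i = x then 1 else 0) + (if s' i = x then 1 else 0)) / m := by
    intro x
    have he : ∑ l ∈ Finset.univ.erase i, (if s l = x then (1 : ℝ) else 0) =
        ∑ l ∈ Finset.univ.erase i, if s' l = x then 1 else 0 :=
      Finset.sum_congr rfl fun l hl => by rw [h l (Finset.ne_of_mem_erase hl)]
    rw [← sub_div, abs_div, Nat.abs_cast, hcard s, hcard s', he, add_sub_add_right_eq_sub]
    gcongr
    split_ifs <;> norm_num
  refine (Finset.sum_le_sum fun x _ => hdiff x).trans_eq ?_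
  rw [← Finset.sum_div, Finset.sum_add_distrib]
  simp only [Finset.sum_ite_eq, Finset.mem_univ, if_true]
  norm_num

theorem iidExp_l1Dist_empiricalTensor_le {T : Tensor4 n} (hm : 0 < m)
    (hT : ∀ x : Obs n, 0 ≤ T x.1 x.2.1 x.2.2.1 x.2.2.2)
    (hT1 : ∑ x : Obs n, T x.1 x.2.1 x.2.2.1 x.2.2.2 = 1) :
    iidExp (fun x : Obs n => T x.1 x.2.1 x.2.2.1 x.2.2.2)
      (fun s : Fin m → Obs n => l1Dist (empiricalTensor s) T) ≤ n ^ 4 / √m := by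
  simp only [l1Dist]
  rw [iidExp_sum]
  refine (Finset.sum_le_sum fun x _ => iidExp_abs_frequency_sub_le hT hT1 hm x).trans_eq ?_
  simp only [Finset.sum_const, Finset.card_univ, Fintype.card_prod, Fintype.card_fin,
    nsmul_eq_mul, Nat.cast_mul]
  ring

/-- Amount by which the correct empirical unfolding loses against the unfolding for `r`. -/
noncomputable def empiricalDeficit (r : QuartetRelation) (s : Fin m → Obs n) : ℝ :=
  nuclearNorm (unfolding (empiricalTensor s) .r12_34) -
    nuclearNorm (unfolding (empiricalTensor s) r)

theorem abs_empiricalDeficit_sub_le (r : QuartetRelation) (s s' : Fin m → Obs n) (i : Fin m)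
    (h : ∀ j, j ≠ i → s j = s' j) : |empiricalDeficit r s - empiricalDeficit r s'| ≤ 4 / m := by
  have hd := l1Dist_empiricalTensor_le h
  have hA := abs_le.mp ((abs_nuclearNorm_unfolding_sub_le _ _ .r12_34).trans hd)
  have hr := abs_le.mp ((abs_nuclearNorm_unfolding_sub_le _ _ r).trans hd)
  have h4 : (4 : ℝ) / m = 2 / m + 2 / m := by ring
  rw [empiricalDeficit, empiricalDeficit, abs_le]
  constructor <;> linarith

theorem iidExp_empiricalDeficit_le {T : Tensor4 n} (hm : 0 < m)
    (hT : ∀ x : Obs n, 0 ≤ T x.1 x.2.1 x.2.2.1 x.2.2.2)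
    (hT1 : ∑ x : Obs n, T x.1 x.2.1 x.2.2.1 x.2.2.2 = 1) {r : QuartetRelation}
    (hr : r ≠ .r12_34) :
    iidExp (fun x : Obs n => T x.1 x.2.1 x.2.2.1 x.2.2.2)
      (fun s : Fin m → Obs n => empiricalDeficit r s) ≤ 2 * (n ^ 4 / √m) - nuclearGap T := by
  have hpt : ∀ s : Fin m → Obs n,
      empiricalDeficit r s ≤ 2 * l1Dist (empiricalTensor s) T + -nuclearGap T := by
    intro s
    have hA := abs_le.mp (abs_nuclearNorm_unfolding_sub_le (empiricalTensor s) T .r12_34)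
    have hB := abs_le.mp (abs_nuclearNorm_unfolding_sub_le (empiricalTensor s) T r)
    have := nuclearGap_le_of_ne T hr
    rw [empiricalDeficit]
    linarith
  refine (iidExp_mono hT hpt).trans ?_
  rw [iidExp_add, iidExp_mul_left, iidExp_const hT1]
  linarith [iidExp_l1Dist_empiricalTensor_le hm hT hT1]

theorem quartetTest_eq_singleton {s : Fin m → Obs n}
    (h : ∀ r, r ≠ .r12_34 → empiricalDeficit r s < 0) : quartetTest s = {.r12_34} := by
  ext r
  simp only [quartetTest, Set.mem_ofPred_eq, Set.mem_singleton_iff]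
  constructor
  · intro hr
    by_contra hne
    have := h r hne
    rw [empiricalDeficit] at this
    linarith [hr .r12_34]
  · rintro rfl r'
    by_cases hne : r' = .r12_34
    · rw [hne]
    · have := h r' hne
      rw [empiricalDeficit] at this
      linarith

end Empirical

theorem mainTheorem5 :
    ∃ m₀ : ℕ → ℝ → ℕ,
      ∀ (n k : ℕ) (M : QuartetModel n k), M.RecoveryCondition →
      ∀ (m : ℕ), m₀ n M.alpha ≤ m →
      ∀ (Ω : Type*) [MeasurableSpace Ω] (μ : Measure Ω) [IsProbabilityMeasure μ]
        (X : Fin m → Ω → Obs n),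
        (∀ l, Measurable (X l)) →
        iIndepFun X μ →
        (∀ l x₁ x₂ x₃ x₄, μ.real {ω | X l ω = (x₁, x₂, x₃, x₄)} = M.tensor x₁ x₂ x₃ x₄) →
        1 - 8 * Real.exp (-(m * M.alpha ^ 2 / 32)) ≤
          μ.real {ω | quartetTest (fun l => X l ω) = {QuartetRelation.r12_34}} := by
  -- At this threshold the bias `2 n⁴ / √m` of the empirical gaps is at most `α / 2`.
  refine ⟨fun n a => ⌈(4 * (n : ℝ) ^ 4 / a) ^ 2⌉₊, ?_⟩
  intro n k M hM m hm Ω _ μ _ X hX hind hlaw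
  -- For `m = 0` or `α = 0` the claimed bound is negative.
  have htriv : (m : ℝ) * M.alpha ^ 2 = 0 → 1 - 8 * Real.exp (-(m * M.alpha ^ 2 / 32)) ≤
      μ.real {ω | quartetTest (fun l => X l ω) = {QuartetRelation.r12_34}} := by
    intro h
    rw [h]
    norm_num
    linarith [measureReal_nonneg (μ := μ)
      (s := {ω | quartetTest (fun l => X l ω) = {QuartetRelation.r12_34}})]
  rcases Nat.eq_zero_or_pos m with hm0 | hm0
  · exact htriv (by simp [hm0])
  rcases (M.alpha_nonneg hM).eq_or_lt with ha | ha
  · exact htriv (by simp [← ha])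
  have hbias : 2 * ((n : ℝ) ^ 4 / √m) ≤ M.alpha / 2 := by
    have hm1 : (4 * (n : ℝ) ^ 4 / M.alpha) ^ 2 ≤ m := (Nat.le_ceil _).trans (by exact_mod_cast hm)
    have hm2 := Real.le_sqrt_of_sq_le hm1
    have hpos : 0 < √(m : ℝ) := Real.sqrt_pos.mpr (by exact_mod_cast hm0)
    rw [div_le_iff₀ ha] at hm2
    rw [← mul_div_assoc, div_le_iff₀ hpos]
    linarith
  have hp : ∀ x : Obs n, 0 ≤ M.tensor x.1 x.2.1 x.2.2.1 x.2.2.2 := fun x => M.tensor_nonneg _ _ _ _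
  have hbad : ∀ r : QuartetRelation, r ≠ .r12_34 →
      μ.real {ω | 0 ≤ empiricalDeficit r fun l => X l ω} ≤
        Real.exp (-(m * M.alpha ^ 2 / 32)) := by
    intro r hr
    have heq := measureReal_eq_iidExp_indicator hX hind
      (p := fun x : Obs n => M.tensor x.1 x.2.1 x.2.2.1 x.2.2.2)
      (fun l x => hlaw l x.1 x.2.1 x.2.2.1 x.2.2.2) {s | 0 ≤ empiricalDeficit r s}
    refine heq.trans_le (iidExp_indicator_nonneg_le hp M.sum_tensor hm0 ha _
      (abs_empiricalDeficit_sub_le r) ?_)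
    have hmean := iidExp_empiricalDeficit_le (T := M.tensor) hm0 hp M.sum_tensor hr
    change _ ≤ _ - M.alpha at hmean
    linarith
  have hcover : Set.univ ⊆ {ω | quartetTest (fun l => X l ω) = {QuartetRelation.r12_34}} ∪
      ({ω | 0 ≤ empiricalDeficit .r13_24 fun l => X l ω} ∪
        {ω | 0 ≤ empiricalDeficit .r14_23 fun l => X l ω}) := by
    intro ω _
    by_contra hω
    simp only [Set.mem_union, Set.mem_ofPred_eq, not_or, not_le] at hω
    refine hω.1 (quartetTest_eq_singleton fun r hr => ?_)
    cases r with
    | r12_34 => exact absurd rfl hr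
    | r13_24 => exact hω.2.1
    | r14_23 => exact hω.2.2
  have h1 := measureReal_mono (μ := μ) hcover
  rw [probReal_univ] at h1
  have h2 := h1.trans (measureReal_union_le _ _)
  have h3 := measureReal_union_le (μ := μ)
    {ω | 0 ≤ empiricalDeficit .r13_24 fun l => X l ω}
    {ω | 0 ≤ empiricalDeficit .r14_23 fun l => X l ω}
  have hB := hbad .r13_24 (by simp)
  have hC := hbad .r14_23 (by simp)
  have hexp := Real.exp_pos (-(m * M.alpha ^ 2 / 32))
  linarith
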